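/- Let $\mathfrak h$ be a separable complex Hilbert space (inner products $\langle\cdot|\cdot\rangle$ conjugate-linear in the first argument) and let $j:\mathfrak h\to\mathfrak h$ be a conjugation, meaning here a conjugate-linear isometry (for instance, complex conjugation of the coordinates in an orthonormal basis; $j^2=1$ is not needed). Let $\Gamma_+(\mathfrak h)=\bigoplus_{n\ge0}\mathfrak h^{\hat\otimes n}$ be the Boson Fock space, where $\mathfrak h^{\hat\otimes n}$ is the closed linear span in $\mathfrak h^{\otimes n}$ of the vectors $f_1\hat\otimes\cdots\hat\otimes f_n=\frac1{n!}\sum_{\sigma\in\mathfrak S_n}f_{\sigma(1)}\otimes\cdots\otimes f_{\sigma(n)}$, with vacuum vector spanning $\mathfrak h^{\hat\otimes0}$. On the linear span of these vectors ($n\ge 0$) the usual Boson fields act by $$B^+(\phi)\,f_1\hat\otimes\cdots\hat\otimes f_n=\sqrt{n+1}\;\phi\hat\otimes f_1\hat\otimes\cdots\hat\otimes f_n,\qquad B^-(\phi)\,f_1\hat\otimes\cdots\hat\otimes f_n=\frac1{\sqrt n}\sum_{k=1}^n\langle\phi|f_k\rangle\,f_1\hat\otimes\cdots\hat\otimes\widehat{f_k}\hat\otimes\cdots\hat\otimes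 f_n ,$$ where $\widehat{f_k}$ means that $f_k$ is left out, and $B^-(\phi)$ kills the vacuum. Let $B_1^\pm$ and $B_2^\pm$ denote these fields on the first and second factor of $\Gamma_+(\mathfrak h)\otimes\Gamma_+(\mathfrak h)$, and on the dense subspace that is the algebraic tensor product of the two spans define $$B^\pm(f)=B_1^\pm(f)\otimes1_2+1_1\otimes B_2^\mp(jf),\qquad N(f,g)=B^+(f)B^-(g)\qquad(f,g\in\mathfrak h).$$ Let $\Omega=\Omega_1\otimes\Omega_2$ be the joint vacuum. Then: 1. All these fields commute: $[B^-(f),B^+(g)]=[B^+(f),B^+(g)]=[B^-(f),B^-(g)]=0$ for all $f,g\in\mathfrak h$. 2. For all $n\ge0$ and $f_1,\dots,f_n,g_1,\dots,g_n\in\mathfrak h$, $$\langle\Omega|\,N(f_n,g_n)\cdots N(f_1,g_1)\,\Omega\rangle=\sum_{\sigma\in\mathfrak S_n}\ \prod_{(i(1),\dots,i(k))\in\sigma}\langle g_{i(k)}|f_{i(k-1)}\rangle\cdots\langle g_{i(2)}|f_{i(1)}\rangle\,\langle g_{i(1)}|f_{i(k)}\rangle ,$$ where the product is over all cycles $(i(1),\dots,i(k))$,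 $i(m+1)=\sigma(i(m))$, of $\sigma$, fixed points included. 3. For every $f\ne0$ the operator $N(f,f)$ has in the joint vacuum the exponential distribution with mean $\|f\|^2$: this distribution is the one and only probability measure $\mu$ on $\mathbb R$ which has moments of all orders and satisfies $\int x^n\,d\mu(x)=\langle\Omega|\,N(f,f)^n\,\Omega\rangle$ for all $n\ge0$. In particular, in the one-dimensional case $\mathfrak h=\mathbb C$, $f=1$, $N$ has the standard exponential distribution. -/

import Mathlib

open scoped TensorProduct

noncomputable section

namespace BosonFock

variable (h : Type*) [NormedAddCommGroup h] [InnerProductSpace ℂ h]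

/-- The algebraic `n`-fold tensor power of `h`. It is a type of its own, so that it carries the
Hilbert space norm and not the projective norm of `PiTensorProduct`. -/
def TensorPow (n : ℕ) : Type _ := PiTensorProduct ℂ (fun _ : Fin n => h)

instance (n : ℕ) : AddCommGroup (TensorPow h n) :=
  inferInstanceAs (AddCommGroup (PiTensorProduct ℂ (fun _ : Fin n => h)))

instance (n : ℕ) : Module ℂ (TensorPow h n) :=
  inferInstanceAs (Module ℂ (PiTensorProduct ℂ (fun _ : Fin n => h)))

variable {h}

/-- The elementary tensor `f₁ ⊗ ⋯ ⊗ fₙ`. -/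
def tensor {n : ℕ} : MultilinearMap ℂ (fun _ : Fin n => h) (TensorPow h n) :=
  PiTensorProduct.tprod ℂ

/-- The linear map on the tensor power given by a multilinear map. -/
def liftTensor {n : ℕ} {E : Type*} [AddCommGroup E] [Module ℂ E]
    (F : MultilinearMap ℂ (fun _ : Fin n => h) E) : TensorPow h n →ₗ[ℂ] E :=
  PiTensorProduct.lift F

@[simp] theorem liftTensor_tensor {n : ℕ} {E : Type*} [AddCommGroup E] [Module ℂ E]
    (F : MultilinearMap ℂ (fun _ : Fin n => h) E) (f : Fin n → h) :
    liftTensor F (tensor f) = F f :=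
  PiTensorProduct.lift.tprod f

theorem hom_ext {n : ℕ} {E : Type*} [AddCommGroup E] [Module ℂ E]
    {S T : TensorPow h n →ₗ[ℂ] E} (H : ∀ f : Fin n → h, S (tensor f) = T (tensor f)) : S = T :=
  PiTensorProduct.ext (MultilinearMap.ext H)

theorem span_tensor (n : ℕ) :
    Submodule.span ℂ (Set.range (tensor : (Fin n → h) → TensorPow h n)) = ⊤ :=
  PiTensorProduct.span_tprod_eq_top

/-- The map `x ↦ φ ⊗ x`. -/
def consTensor (n : ℕ) : h →ₗ[ℂ] TensorPow h n →ₗ[ℂ] TensorPow h (n + 1) where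
  toFun φ := liftTensor ((tensor (h := h) (n := n + 1)).curryLeft φ)
  map_add' φ ψ := hom_ext fun f => by simp
  map_smul' c φ := hom_ext fun f => by simp

@[simp] theorem consTensor_tensor {n : ℕ} (φ : h) (f : Fin n → h) :
    consTensor n φ (tensor f) = tensor (Fin.cons φ f : Fin (n + 1) → h) := by
  simp [consTensor]

/-- The isomorphism of the `(n + 1)`-st tensor power with `h ⊗ (n`-th tensor power`)`. -/
def splitHead (n : ℕ) : TensorPow h (n + 1) ≃ₗ[ℂ] h ⊗[ℂ] TensorPow h n :=
  LinearEquiv.ofLinearMap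
    (liftTensor (LinearMap.uncurryLeft (M := fun _ : Fin (n + 1) => h)
      { toFun := fun φ => (TensorProduct.mk ℂ h (TensorPow h n) φ).compMultilinearMap tensor
        map_add' := fun φ ψ => by ext; simp
        map_smul' := fun c φ => by ext; simp [TensorProduct.smul_tmul'] }))
    (TensorProduct.lift (consTensor n))
    (by
      apply TensorProduct.ext
      apply LinearMap.ext
      intro φ
      apply hom_ext
      intro f
      simp [Fin.tail_def])
    (by
      apply hom_ext
      intro f
      simp)

@[simp] theorem splitHead_tensor {n : ℕ} (f : Fin (n + 1) → h) :
    splitHead n (tensor f) = f 0 ⊗ₜ[ℂ] tensor (Fin.tail f) := by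
  simp [splitHead]

/-- The zeroth tensor power is the field of scalars. -/
def emptyTensor : TensorPow h 0 ≃ₗ[ℂ] ℂ := PiTensorProduct.isEmptyEquiv (Fin 0)

@[simp] theorem emptyTensor_tensor (f : Fin 0 → h) : emptyTensor (tensor f) = 1 :=
  PiTensorProduct.isEmptyEquiv_apply_tprod (ι := Fin 0) f

/-- Transport of an inner product along a linear isomorphism. -/
@[reducible]
def coreOfEquiv {V E : Type*} [AddCommGroup V] [Module ℂ V] [NormedAddCommGroup E]
    [InnerProductSpace ℂ E] (e : V ≃ₗ[ℂ] E) : InnerProductSpace.Core ℂ V where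
  inner x y := inner ℂ (e x) (e y)
  conj_inner_symm x y := inner_conj_symm _ _
  re_inner_nonneg x := inner_self_nonneg
  add_left x y z := by rw [map_add, inner_add_left]
  smul_left x y r := by rw [map_smul, inner_smul_left]
  definite x hx := by simpa using hx

/-- The inner product on the tensor power, obtained by iterating the tensor product of two inner
product spaces; it is determined by the formula `inner_tensor` below. -/
@[reducible]
def tensorCore : (n : ℕ) → InnerProductSpace.Core ℂ (TensorPow h n)
  | 0 => coreOfEquiv emptyTensor
  | n + 1 =>
    letI : NormedAddCommGroup (TensorPow h n) := (tensorCore n).toNormedAddCommGroup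
    letI : InnerProductSpace ℂ (TensorPow h n) := .ofCore _
    coreOfEquiv (splitHead n)

instance (n : ℕ) : NormedAddCommGroup (TensorPow h n) := (tensorCore n).toNormedAddCommGroup

instance (n : ℕ) : InnerProductSpace ℂ (TensorPow h n) := .ofCore _

/-- `⟪f₁ ⊗ ⋯ ⊗ fₙ, g₁ ⊗ ⋯ ⊗ gₙ⟫ = ⟪f₁, g₁⟫ ⋯ ⟪fₙ, gₙ⟫`. -/
theorem inner_tensor {n : ℕ} (f g : Fin n → h) :
    inner ℂ (tensor f) (tensor g) = ∏ i, inner ℂ (f i) (g i) := by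
  induction n with
  | zero =>
    change inner ℂ (emptyTensor (tensor f)) (emptyTensor (tensor g)) = _
    simp
  | succ n ih =>
    change inner ℂ (splitHead n (tensor f)) (splitHead n (tensor g)) = _
    rw [splitHead_tensor, splitHead_tensor, TensorProduct.inner_tmul, ih, Fin.prod_univ_succ]
    rfl

/-- The symmetrized tensor `(1 / n!) ∑ σ, f_{σ(1)} ⊗ ⋯ ⊗ f_{σ(n)}`, in the tensor power. -/
def symTensor {n : ℕ} (f : Fin n → h) : TensorPow h n :=
  ((n.factorial : ℂ)⁻¹) • ∑ σ : Equiv.Perm (Fin n), tensor (fun i => f (σ i))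

variable (h) in
/-- The algebraic symmetric tensor power: the linear span of the symmetrized tensors. -/
def SymPow (n : ℕ) : Submodule ℂ (TensorPow h n) :=
  Submodule.span ℂ (Set.range (symTensor : (Fin n → h) → TensorPow h n))

/-- The action of a permutation, `f₁ ⊗ ⋯ ⊗ fₙ ↦ f_{σ(1)} ⊗ ⋯ ⊗ f_{σ(n)}`. -/
def permute {n : ℕ} (σ : Equiv.Perm (Fin n)) : TensorPow h n →ₗ[ℂ] TensorPow h n :=
  liftTensor ((tensor (h := h) (n := n)).domDomCongr σ)

/-- The symmetrization projection. -/
def symmetrizer (n : ℕ) : TensorPow h n →ₗ[ℂ] TensorPow h n :=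
  ((n.factorial : ℂ)⁻¹) • ∑ σ : Equiv.Perm (Fin n), permute σ

@[simp] theorem symmetrizer_tensor {n : ℕ} (f : Fin n → h) :
    symmetrizer n (tensor f) = symTensor f := by
  simp [symmetrizer, symTensor, permute]

theorem symmetrizer_mem {n : ℕ} (x : TensorPow h n) : symmetrizer n x ∈ SymPow h n := by
  have hx : x ∈ Submodule.span ℂ (Set.range (tensor : (Fin n → h) → TensorPow h n)) := by
    rw [span_tensor]; trivial
  induction hx using Submodule.span_induction with
  | mem x hx =>
    obtain ⟨f, rfl⟩ := hx
    rw [symmetrizer_tensor]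
    exact Submodule.subset_span ⟨f, rfl⟩
  | zero => rw [map_zero]; exact zero_mem _
  | add x y _ _ hx hy => rw [map_add]; exact add_mem hx hy
  | smul c x _ hx => rw [map_smul]; exact Submodule.smul_mem _ c hx

theorem symTensor_comp {n : ℕ} (f : Fin n → h) (τ : Equiv.Perm (Fin n)) :
    symTensor (fun i => f (τ i)) = symTensor f := by
  unfold symTensor
  congr 1
  exact Fintype.sum_equiv (Equiv.mulLeft τ) _ _ fun σ => rfl

/-- The symmetrized tensor as an element of the symmetric tensor power. -/
def symVec {n : ℕ} (f : Fin n → h) : SymPow h n :=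
  ⟨symTensor f, Submodule.subset_span ⟨f, rfl⟩⟩

/-- The symmetrization projection as a map onto the symmetric tensor power. -/
def toSym (n : ℕ) : TensorPow h n →ₗ[ℂ] SymPow h n :=
  (symmetrizer n).codRestrict (SymPow h n) symmetrizer_mem

@[simp] theorem toSym_tensor {n : ℕ} (f : Fin n → h) : toSym n (tensor f) = symVec f := by
  apply Subtype.ext
  exact symmetrizer_tensor f

theorem toSym_cons_sym {n : ℕ} (φ : h) (f : Fin n → h) :
    toSym (n + 1) (consTensor n φ (symTensor f)) =
      symVec (Fin.cons φ f : Fin (n + 1) → h) := by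
  have key : ∀ σ : Equiv.Perm (Fin n),
      symTensor (Fin.cons φ (fun i => f (σ i)) : Fin (n + 1) → h) =
        symTensor (Fin.cons φ f : Fin (n + 1) → h) := by
    intro σ
    rw [← symTensor_comp (Fin.cons φ f : Fin (n + 1) → h) (Equiv.Perm.decomposeFin.symm (0, σ))]
    congr 1
    funext i
    refine Fin.cases ?_ (fun i => ?_) i <;> simp
  apply Subtype.ext
  have h1 : (n.factorial : ℂ) ≠ 0 := by exact_mod_cast n.factorial_ne_zero
  rw [symTensor]
  simp only [map_smul, map_sum, consTensor_tensor, toSym_tensor]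
  simp [symVec, key, Fintype.card_perm]
  rw [← Nat.cast_smul_eq_nsmul ℂ, smul_smul, inv_mul_cancel₀ h1, one_smul]

/-- Contraction of the first factor, `f₁ ⊗ ⋯ ⊗ fₙ₊₁ ↦ ⟪φ, f₁⟫ f₂ ⊗ ⋯ ⊗ fₙ₊₁`. -/
def contract {n : ℕ} (φ : h) : TensorPow h (n + 1) →ₗ[ℂ] TensorPow h n :=
  TensorProduct.lid ℂ (TensorPow h n) ∘ₗ
    TensorProduct.map (innerₛₗ ℂ φ) LinearMap.id ∘ₗ (splitHead n).toLinearMap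

@[simp] theorem contract_tensor {n : ℕ} (φ : h) (f : Fin (n + 1) → h) :
    contract φ (tensor f) = inner ℂ φ (f 0) • tensor (Fin.tail f) := by
  simp [contract]

theorem symVec_comp {n : ℕ} (f : Fin n → h) (τ : Equiv.Perm (Fin n)) :
    symVec (fun i => f (τ i)) = symVec f := Subtype.ext (symTensor_comp f τ)

theorem symVec_tail {n : ℕ} (f : Fin (n + 1) → h) (σ : Equiv.Perm (Fin (n + 1))) :
    symVec (fun i : Fin n => f (σ i.succ)) =
      symVec (fun i : Fin n => f ((σ 0).succAbove i)) := by
  obtain ⟨⟨p, τ⟩, hτ⟩ := Equiv.Perm.decomposeFin.symm.surjective ((σ 0).cycleRange * σ)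
  have hp : p = 0 := by
    have := congrArg (fun e : Equiv.Perm (Fin (n + 1)) => e 0) hτ
    simpa using this
  subst hp
  rw [← symVec_comp (fun i : Fin n => f ((σ 0).succAbove i)) τ]
  congr 1
  funext i
  have := congrArg (fun e : Equiv.Perm (Fin (n + 1)) => e i.succ) hτ
  simp only [Equiv.Perm.coe_mul, Function.comp_apply] at this
  rw [← Fin.cycleRange_symm_succ, (Equiv.eq_symm_apply _).2 this.symm]
  simp

theorem toSym_contract_sym {n : ℕ} (φ : h) (f : Fin (n + 1) → h) :
    toSym n (contract φ (symTensor f)) =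
      ((n + 1 : ℂ)⁻¹) • ∑ j : Fin (n + 1),
        inner ℂ φ (f j) • symVec (fun i : Fin n => f (j.succAbove i)) := by
  have h1 : (n.factorial : ℂ) ≠ 0 := by exact_mod_cast n.factorial_ne_zero
  rw [symTensor]
  simp only [map_smul, map_sum, contract_tensor, toSym_tensor]
  have : ∀ σ : Equiv.Perm (Fin (n + 1)),
      inner ℂ φ (f (σ 0)) • symVec (Fin.tail fun i => f (σ i)) =
      (fun j : Fin (n + 1) => inner ℂ φ (f j) •
        symVec (fun i : Fin n => f (j.succAbove i))) (σ 0) := by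
    intro σ
    exact congrArg _ (symVec_tail f σ)
  rw [Finset.sum_congr rfl fun σ _ => this σ,
    ← Equiv.sum_comp Equiv.Perm.decomposeFin.symm, Fintype.sum_prod_type]
  simp only [Equiv.Perm.decomposeFin_symm_apply_zero, Finset.sum_const, Finset.card_univ,
    Fintype.card_perm, Fintype.card_fin]
  rw [← Finset.smul_sum, ← Nat.cast_smul_eq_nsmul ℂ, smul_smul, Nat.factorial_succ]
  congr 1
  push_cast
  field_simp

open UniformSpace (Completion)

variable (h) in
/-- The closed linear span of the symmetrized tensors in the Hilbert space tensor power, which is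
the completion of the algebraic one. -/
def closedSymSpan (n : ℕ) : Submodule ℂ (Completion (TensorPow h n)) :=
  (Submodule.span ℂ
    (Set.range fun f : Fin n → h => (symTensor f : Completion (TensorPow h n)))).topologicalClosure

variable (h) in
/-- The `n`-fold symmetric tensor power of `h`, a Hilbert space. -/
def HilbertSymPow (n : ℕ) : Type _ := closedSymSpan h n

instance (n : ℕ) : NormedAddCommGroup (HilbertSymPow h n) :=
  inferInstanceAs (NormedAddCommGroup (closedSymSpan h n))

instance (n : ℕ) : InnerProductSpace ℂ (HilbertSymPow h n) :=
  inferInstanceAs (InnerProductSpace ℂ (closedSymSpan h n))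

instance (n : ℕ) : CompleteSpace (HilbertSymPow h n) :=
  Submodule.topologicalClosure.completeSpace _

variable (h) in
/-- The Boson Fock space over `h`: the Hilbert space direct sum of the symmetric tensor powers. -/
def Fock : Type _ := lp (fun n : ℕ => HilbertSymPow h n) 2

instance : NormedAddCommGroup (Fock h) :=
  inferInstanceAs (NormedAddCommGroup (lp (fun n : ℕ => HilbertSymPow h n) 2))

instance : InnerProductSpace ℂ (Fock h) :=
  inferInstanceAs (InnerProductSpace ℂ (lp (fun n : ℕ => HilbertSymPow h n) 2))

instance : CompleteSpace (Fock h) :=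
  inferInstanceAs (CompleteSpace (lp (fun n : ℕ => HilbertSymPow h n) 2))

variable (h) in
/-- The inclusion of the `n`-particle space into Fock space. -/
def number (n : ℕ) : HilbertSymPow h n →ₗᵢ[ℂ] Fock h where
  toLinearMap := (lp.lsingle 2 n : HilbertSymPow h n →ₗ[ℂ] lp (fun n : ℕ => HilbertSymPow h n) 2)
  norm_map' := fun x => lp.norm_single (E := fun n : ℕ => HilbertSymPow h n) (p := 2) (by norm_num) n x

variable (h) in
/-- The domain of the Boson fields: finite linear combinations of vectors `f₁ ⊗̂ ⋯ ⊗̂ fₙ`, `n ≥ 0`.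
It is embedded in Fock space as a dense subspace by `toFock`. -/
def FiniteFock : Type _ := DirectSum ℕ fun n => SymPow h n

instance : AddCommGroup (FiniteFock h) :=
  inferInstanceAs (AddCommGroup (DirectSum ℕ fun n => SymPow h n))

instance : Module ℂ (FiniteFock h) :=
  inferInstanceAs (Module ℂ (DirectSum ℕ fun n => SymPow h n))

/-- The inclusion of the `n`-particle sector into the domain of the Boson fields. -/
def sector (n : ℕ) : SymPow h n →ₗ[ℂ] FiniteFock h :=
  DirectSum.lof ℂ ℕ (fun n => SymPow h n) n

/-- The linear map on the domain of the Boson fields with given restrictions to the sectors. -/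
def liftSectors {E : Type*} [AddCommGroup E] [Module ℂ E] (T : (n : ℕ) → SymPow h n →ₗ[ℂ] E) :
    FiniteFock h →ₗ[ℂ] E :=
  DirectSum.toModule ℂ ℕ E T

@[simp] theorem liftSectors_sector {E : Type*} [AddCommGroup E] [Module ℂ E]
    (T : (n : ℕ) → SymPow h n →ₗ[ℂ] E) (n : ℕ) (y : SymPow h n) :
    liftSectors T (sector n y) = T n y :=
  DirectSum.toModule_lof (M := fun n => SymPow h n) (φ := T) ℂ n y

theorem sector_hom_ext {E : Type*} [AddCommGroup E] [Module ℂ E] {S T : FiniteFock h →ₗ[ℂ] E}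
    (H : ∀ (n : ℕ) (y : SymPow h n), S (sector n y) = T (sector n y)) : S = T :=
  DirectSum.linearMap_ext ℂ fun n => LinearMap.ext (H n)

theorem coe_span (n : ℕ) :
    Submodule.span ℂ (Set.range fun f : Fin n → h => (symTensor f : Completion (TensorPow h n))) =
      (SymPow h n).map (Completion.toComplₗᵢ (𝕜 := ℂ) (E := TensorPow h n)).toLinearMap := by
  rw [SymPow, Submodule.map_span, ← Set.range_comp]
  rfl

theorem coe_mem {n : ℕ} (x : SymPow h n) :
    ((x : TensorPow h n) : Completion (TensorPow h n)) ∈ closedSymSpan h n := by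
  apply Submodule.le_topologicalClosure
  rw [coe_span]
  exact Submodule.mem_map_of_mem x.2

/-- The inclusion of the algebraic symmetric tensor power into its Hilbert space completion. -/
def levelIncl (n : ℕ) : SymPow h n →ₗ[ℂ] HilbertSymPow h n :=
  ((Completion.toComplₗᵢ (𝕜 := ℂ) (E := TensorPow h n)).toLinearMap ∘ₗ
    (SymPow h n).subtype).codRestrict (closedSymSpan h n) coe_mem

/-- The inclusion of the domain of the Boson fields into Fock space. -/
def toFock : FiniteFock h →ₗ[ℂ] Fock h :=
  liftSectors fun n => (number h n).toLinearMap ∘ₗ levelIncl n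

theorem toFock_sector (n : ℕ) (y : SymPow h n) :
    toFock (sector n y) = number h n (levelIncl n y) := by
  rw [toFock, liftSectors_sector]
  rfl

/-- The `n`-particle component of a vector of Fock space. -/
def component (n : ℕ) : Fock h →ₗ[ℂ] HilbertSymPow h n where
  toFun x := (show lp (fun n : ℕ => HilbertSymPow h n) 2 from x) n
  map_add' _ _ := rfl
  map_smul' _ _ := rfl

/-- The `n`-particle component of a vector in the domain of the Boson fields. -/
def finiteComponent (n : ℕ) : FiniteFock h →ₗ[ℂ] SymPow h n :=
  DirectSum.component ℂ ℕ (fun n => SymPow h n) n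

theorem component_toFock (x : FiniteFock h) (n : ℕ) :
    component n (toFock x) = levelIncl n (finiteComponent n x) := by
  have : component n ∘ₗ toFock (h := h) = levelIncl n ∘ₗ finiteComponent n := by
    apply sector_hom_ext
    intro m y
    rw [LinearMap.comp_apply, LinearMap.comp_apply, toFock_sector]
    by_cases hn : m = n
    · subst hn
      have h1 : finiteComponent m (sector m y) = y :=
        DirectSum.component.lof_self (M := fun n => SymPow h n) ℂ m y
      rw [h1]
      exact lp.single_apply_self (E := fun n : ℕ => HilbertSymPow h n) 2 m _
    · have h1 : finiteComponent n (sector m y) = 0 :=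
        (DirectSum.component.of (M := fun n => SymPow h n) ℂ n m y).trans (dif_neg hn)
      rw [h1, map_zero]
      exact lp.single_apply_ne (E := fun n : ℕ => HilbertSymPow h n) 2 m _ (Ne.symm hn)
  exact congrArg (fun T => T x) this

theorem levelIncl_injective (n : ℕ) : Function.Injective (levelIncl (h := h) n) := by
  intro x y hxy
  have := congrArg (Subtype.val) hxy
  exact Subtype.ext (Completion.coe_injective _ this)

theorem toFock_injective : Function.Injective (toFock (h := h)) := by
  intro x y hxy
  refine DFinsupp.ext fun n => ?_
  change finiteComponent n x = finiteComponent n y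
  apply levelIncl_injective
  rw [← component_toFock, ← component_toFock, hxy]

variable (h) in
/-- The Hilbert space tensor product of two copies of Fock space. -/
abbrev DoubleFock : Type _ := Completion (Fock h ⊗[ℂ] Fock h)

variable (h) in
/-- The domain of the fields on the double Fock space: finite linear combinations of vectors
`(f₁ ⊗̂ ⋯ ⊗̂ fₙ) ⊗ (g₁ ⊗̂ ⋯ ⊗̂ gₘ)`. It is embedded in the double Fock space as a dense subspace by
`toDoubleFock`, and the fields map it into itself. -/
abbrev FiniteDoubleFock : Type _ := FiniteFock h ⊗[ℂ] FiniteFock h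

/-- The inclusion of the domain of the fields into the double Fock space. -/
def toDoubleFock : FiniteDoubleFock h →ₗ[ℂ] DoubleFock h :=
  (Completion.toComplₗᵢ (𝕜 := ℂ) (E := Fock h ⊗[ℂ] Fock h)).toLinearMap ∘ₗ
    TensorProduct.map toFock toFock

theorem toDoubleFock_injective : Function.Injective (toDoubleFock (h := h)) :=
  (Completion.toComplₗᵢ (𝕜 := ℂ) (E := Fock h ⊗[ℂ] Fock h)).injective.comp
    (TensorProduct.map_injective_of_flat_flat _ _ toFock_injective toFock_injective)

theorem levelIncl_denseRange (n : ℕ) : DenseRange (levelIncl (h := h) n) := by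
  intro x
  have hx : (show closedSymSpan h n from x).1 ∈ closure
      (Submodule.span ℂ (Set.range fun f : Fin n → h =>
        (symTensor f : Completion (TensorPow h n))) : Set (Completion (TensorPow h n))) :=
    (show closedSymSpan h n from x).2
  rw [coe_span] at hx
  refine closure_subtype.2 (closure_mono ?_ hx)
  rintro _ ⟨z, hz, rfl⟩
  exact ⟨levelIncl n ⟨z, hz⟩, ⟨_, rfl⟩, rfl⟩

theorem toFock_denseRange : DenseRange (toFock (h := h)) := by
  intro x
  have hs : HasSum (fun n => number h n (component n x)) x :=
    lp.hasSum_single (E := fun n : ℕ => HilbertSymPow h n) (p := 2) (by simp) x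
  change x ∈ ((LinearMap.range (toFock (h := h))).topologicalClosure : Set (Fock h))
  refine (Submodule.isClosed_topologicalClosure _).mem_of_tendsto hs
    (Filter.Eventually.of_forall fun s => ?_)
  refine Submodule.sum_mem _ fun n _ => ?_
  have h1 : Set.MapsTo (number h n) (Set.range (levelIncl n))
      (LinearMap.range (toFock (h := h))) := by
    rintro _ ⟨y, rfl⟩
    exact ⟨sector n y, toFock_sector n y⟩
  exact h1.closure (number h n).continuous (levelIncl_denseRange n (component n x))

theorem toDoubleFock_denseRange : DenseRange (toDoubleFock (h := h)) := by
  have h2 : DenseRange (TensorProduct.map (toFock (h := h)) (toFock (h := h))) := by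
    intro x
    change x ∈ ((LinearMap.range
      (TensorProduct.map (toFock (h := h)) (toFock (h := h)))).topologicalClosure : Set _)
    induction x using TensorProduct.induction_on with
    | zero => exact zero_mem _
    | add x y hx hy => exact add_mem hx hy
    | tmul a b =>
      have hab : (a, b) ∈ closure (Set.range (toFock (h := h)) ×ˢ Set.range (toFock (h := h))) := by
        rw [closure_prod_eq]
        exact ⟨toFock_denseRange a, toFock_denseRange b⟩
      refine Set.MapsTo.closure (f := fun p : Fock h × Fock h => p.1 ⊗ₜ[ℂ] p.2) ?_
        TensorProduct.continuous_tmul hab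
      rintro ⟨_, _⟩ ⟨⟨x, rfl⟩, ⟨y, rfl⟩⟩
      exact ⟨x ⊗ₜ y, by simp⟩
  exact (Completion.denseRange_coe).comp h2 (Completion.continuous_coe _)

/-- The vector `f₁ ⊗̂ ⋯ ⊗̂ fₙ` in the `n`-particle sector. -/
def fockVec {n : ℕ} (f : Fin n → h) : FiniteFock h := sector n (symVec f)

/-- The Boson creation field; `creation_fockVec` gives its action. -/
def creation (φ : h) : Module.End ℂ (FiniteFock h) :=
  liftSectors fun n => (√(n + 1 : ℝ) : ℂ) •
    (sector (n + 1) ∘ₗ toSym (n + 1) ∘ₗ consTensor n φ ∘ₗ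
      (SymPow h n).subtype)

/-- The Boson annihilation field on the `n`-particle sector. -/
def annihilationLevel (φ : h) : (n : ℕ) → SymPow h n →ₗ[ℂ] FiniteFock h
  | 0 => 0
  | n + 1 => (√(n + 1 : ℝ) : ℂ) •
      (sector n ∘ₗ toSym n ∘ₗ contract φ ∘ₗ
      (SymPow h (n + 1)).subtype)

/-- The Boson annihilation field; `annihilation_fockVec` gives its action. -/
def annihilation (φ : h) : Module.End ℂ (FiniteFock h) :=
  liftSectors (annihilationLevel φ)

/-- `B⁺(φ) f₁ ⊗̂ ⋯ ⊗̂ fₙ = √(n + 1) φ ⊗̂ f₁ ⊗̂ ⋯ ⊗̂ fₙ`. -/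
theorem creation_fockVec (φ : h) {n : ℕ} (f : Fin n → h) :
    creation φ (fockVec f) = (√(n + 1 : ℝ) : ℂ) • fockVec (Fin.cons φ f : Fin (n + 1) → h) := by
  rw [creation, fockVec, liftSectors_sector, fockVec, ← toSym_cons_sym]
  rfl

/-- `B⁻(φ) f₁ ⊗̂ ⋯ ⊗̂ fₘ = (1 / √m) ∑ⱼ ⟪φ, fⱼ⟫ f₁ ⊗̂ ⋯ (without fⱼ) ⋯ ⊗̂ fₘ`, for `m = n + 1`. -/
theorem annihilation_fockVec (φ : h) {n : ℕ} (f : Fin (n + 1) → h) :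
    annihilation φ (fockVec f) = ((√(n + 1 : ℝ))⁻¹ : ℂ) •
      ∑ j : Fin (n + 1), inner ℂ φ (f j) • fockVec (fun i : Fin n => f (j.succAbove i)) := by
  have h1 : annihilation φ (fockVec f) = (√(n + 1 : ℝ) : ℂ) •
      sector n (toSym n (contract φ (symTensor f))) := by
    rw [annihilation, fockVec, liftSectors_sector]
    rfl
  have h2 : (√(n + 1 : ℝ) : ℂ) * (n + 1 : ℂ)⁻¹ = ((√(n + 1 : ℝ))⁻¹ : ℂ) := by
    have h3 : (√(n + 1 : ℝ) : ℂ) * (√(n + 1 : ℝ) : ℂ) = (n + 1 : ℂ) := by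
      rw [← Complex.ofReal_mul, Real.mul_self_sqrt (by positivity)]
      push_cast; rfl
    rw [← h3]
    have : (√(n + 1 : ℝ) : ℂ) ≠ 0 := by
      simp only [ne_eq, Complex.ofReal_eq_zero]
      positivity
    field_simp
  rw [h1, toSym_contract_sym, map_smul, smul_smul, h2, map_sum]
  simp only [map_smul]
  rfl

variable (h) in
/-- The Fock vacuum. -/
def vacuum : FiniteFock h := fockVec (Fin.elim0 : Fin 0 → h)

theorem annihilation_vacuum (φ : h) : annihilation φ (vacuum h) = 0 := by
  rw [annihilation, vacuum, fockVec, liftSectors_sector]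
  rfl

/-- The field `B⁺(f) = B₁⁺(f) ⊗ 1 + 1 ⊗ B₂⁻(j f)`. -/
def doubleCreation (j : h →ₗᵢ⋆[ℂ] h) (f : h) : Module.End ℂ (FiniteDoubleFock h) :=
  TensorProduct.map (creation f) LinearMap.id + TensorProduct.map LinearMap.id (annihilation (j f))

/-- The field `B⁻(f) = B₁⁻(f) ⊗ 1 + 1 ⊗ B₂⁺(j f)`. -/
def doubleAnnihilation (j : h →ₗᵢ⋆[ℂ] h) (f : h) : Module.End ℂ (FiniteDoubleFock h) :=
  TensorProduct.map (annihilation f) LinearMap.id + TensorProduct.map LinearMap.id (creation (j f))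

/-- The operator `N(f, g) = B⁺(f) B⁻(g)`. -/
def doubleNumber (j : h →ₗᵢ⋆[ℂ] h) (f g : h) : Module.End ℂ (FiniteDoubleFock h) :=
  doubleCreation j f * doubleAnnihilation j g

variable (h) in
/-- The joint vacuum `Ω = Ω₁ ⊗ Ω₂`. -/
def jointVacuum : FiniteDoubleFock h := vacuum h ⊗ₜ[ℂ] vacuum h

/-- The expectation `⟨Ω | A Ω⟩` in the joint vacuum, an inner product in the double Fock space. -/
def vacuumExpectation (A : Module.End ℂ (FiniteDoubleFock h)) : ℂ :=
  inner ℂ (toDoubleFock (jointVacuum h)) (toDoubleFock (A (jointVacuum h)))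

/-- The factor of the cycle `(i(1), i(2), …, i(k)) = (i, σ i, …, σ^(k - 1) i)` of `σ` through `i`:
the product of `⟪g_{i(m + 1)}, f_{i(m)}⟫` over `m = 1, …, k`, where `i(k + 1) = i(1)`. -/
def cycleFactor {n : ℕ} (f g : Fin n → h) (σ : Equiv.Perm (Fin n)) (i : Fin n) : ℂ :=
  ∏ m ∈ Finset.range (Function.minimalPeriod σ i),
    inner ℂ (g ((σ ^ (m + 1)) i)) (f ((σ ^ m) i))

/-- The product of the factors of all cycles of `σ`, fixed points included. The cycles are the
classes of the relation of lying on the same cycle; the factor of a cycle does not depend on the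
representative at which it starts. -/
def cycleProduct {n : ℕ} (f g : Fin n → h) (σ : Equiv.Perm (Fin n)) : ℂ :=
  letI : DecidableRel (Equiv.Perm.SameCycle.setoid σ).r := Classical.decRel _
  ∏ c : Quotient (Equiv.Perm.SameCycle.setoid σ), cycleFactor f g σ c.out

/-- The probability measure `μ` has all moments, and these are the vacuum moments of `A`. -/
def HasVacuumMoments (A : Module.End ℂ (FiniteDoubleFock h)) (μ : MeasureTheory.Measure ℝ) : Prop :=
  MeasureTheory.IsProbabilityMeasure μ ∧
    ∀ n : ℕ, MeasureTheory.Integrable (fun x : ℝ => x ^ n) μ ∧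
      vacuumExpectation (A ^ n) = ((∫ x, x ^ n ∂μ : ℝ) : ℂ)

/-- The operator `A` has the distribution `μ` in the joint vacuum: `μ` is the one and only
probability measure on the line whose moments are the vacuum moments of `A`. -/
def HasVacuumDistribution (A : Module.End ℂ (FiniteDoubleFock h))
    (μ : MeasureTheory.Measure ℝ) : Prop :=
  HasVacuumMoments A μ ∧ ∀ ν : MeasureTheory.Measure ℝ, HasVacuumMoments A ν → ν = μ

end BosonFock

end

open BosonFock

/-!
The fields `B⁺(f) = B₁⁺(f) + B₂⁻(j f)` and `B⁻(f) = B₁⁻(f) + B₂⁺(j f)` commute because the two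
canonical commutation relations contribute `⟪f, g⟫` and `-⟪j g, j f⟫ = -⟪f, g⟫` to
`[B⁻(f), B⁺(g)]`; see `doubleAnnihilation_commute_doubleCreation`. That annihilation fields commute
with each other is deduced from cyclicity of the vacuum (`annihilation_commute`) instead of from the
formula for a twofold contraction.

Consequently a product of operators `N(fᵢ, gᵢ)` can be sorted into a product of the `B⁺(fᵢ)` times a
product of the `B⁻(gᵢ)`. On the joint vacuum the latter acts only by the creation fields
`B₂⁺(j gᵢ)`, and under the vacuum functional the former acts only by the annihilation fields
`B₂⁻(j fᵢ)`. The vacuum expectation is therefore the inner product of two symmetric tensors in one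
Fock space, the permanent of the matrix `⟪j fᵢ, j gₖ⟫ = ⟪gₖ, fᵢ⟫`
(`vacuumExpectation_doubleNumber_prod`). Grouping the factors of a permutation along its cycles
gives the cycle form (`cycleProduct_eq_prod`).

For equal vectors the permanent is `n! ‖f‖²ⁿ`, the `n`-th moment of the exponential distribution
with mean `‖f‖²`. These moments grow slowly enough for exponential moments to exist near `0`, so that the
complex moment generating function is analytic on a strip around the imaginary axis and is
determined by its Taylor coefficients at `0`, which are given by the moments. As it extends the
characteristic function, the measure is unique (`MeasureTheory.Measure.ext_of_factorial_moments`).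
-/

namespace BosonFock

variable {h : Type*} [NormedAddCommGroup h] [InnerProductSpace ℂ h]

/-! ### The canonical commutation relations on one Fock space -/

theorem fockVec_hom_ext {E : Type*} [AddCommGroup E] [Module ℂ E] {S T : FiniteFock h →ₗ[ℂ] E}
    (H : ∀ (n : ℕ) (f : Fin n → h), S (fockVec f) = T (fockVec f)) : S = T := by
  refine sector_hom_ext fun n y => ?_
  obtain ⟨y, hy⟩ := y
  induction hy using Submodule.span_induction with
  | mem x hx =>
    obtain ⟨f, rfl⟩ := hx
    exact H n f
  | zero =>
    have h0 : (⟨0, zero_mem _⟩ : SymPow h n) = 0 := rfl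
    simp [h0]
  | add x y hx hy ihx ihy =>
    have h0 : (⟨x + y, add_mem hx hy⟩ : SymPow h n) = ⟨x, hx⟩ + ⟨y, hy⟩ := rfl
    exact h0 ▸ by simp only [map_add, ihx, ihy]
  | smul c x hx ihx =>
    have h0 : (⟨c • x, Submodule.smul_mem _ c hx⟩ : SymPow h n) = c • ⟨x, hx⟩ := rfl
    exact h0 ▸ by simp only [map_smul, ihx]

theorem fockVec_comp {n : ℕ} (f : Fin n → h) (τ : Equiv.Perm (Fin n)) :
    fockVec (fun i => f (τ i)) = fockVec f := congrArg (sector n) (symVec_comp f τ)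

theorem fockVec_fin_zero (f : Fin 0 → h) : fockVec f = vacuum h :=
  congrArg fockVec (Subsingleton.elim _ _)

theorem sqrt_succ_ne_zero (n : ℕ) : (√(n + 1 : ℝ) : ℂ) ≠ 0 := by
  simp only [ne_eq, Complex.ofReal_eq_zero]
  positivity

theorem creation_commute (φ ψ : h) : Commute (creation φ) (creation ψ) := by
  refine fockVec_hom_ext fun n f => ?_
  have key : fockVec (Fin.cons φ (Fin.cons ψ f : Fin (n + 1) → h) : Fin (n + 2) → h) =
      fockVec (Fin.cons ψ (Fin.cons φ f : Fin (n + 1) → h) : Fin (n + 2) → h) := by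
    rw [← fockVec_comp _ (Equiv.swap (0 : Fin (n + 2)) 1)]
    congr 1
    funext i
    refine Fin.cases ?_ (fun i => ?_) i
    · rw [Equiv.swap_apply_left]; rfl
    · refine Fin.cases ?_ (fun i => ?_) i
      · rw [Fin.succ_zero_eq_one, Equiv.swap_apply_right]; rfl
      · rw [Equiv.swap_apply_of_ne_of_ne (Fin.succ_ne_zero _)
          (by rw [← Fin.succ_zero_eq_one]; exact (Fin.succ_injective _).ne (Fin.succ_ne_zero _))]
        rfl
  simp only [Module.End.mul_apply, creation_fockVec, map_smul, key]

/-- `a⁻(φ) a⁺(ψ) - a⁺(ψ) a⁻(φ) = ⟪φ, ψ⟫`. -/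
theorem annihilation_mul_creation (φ ψ : h) :
    annihilation φ * creation ψ = creation ψ * annihilation φ + inner ℂ φ ψ • 1 := by
  refine fockVec_hom_ext fun n f => ?_
  simp only [Module.End.mul_apply, LinearMap.add_apply, LinearMap.smul_apply,
    Module.End.one_apply, creation_fockVec, map_smul, annihilation_fockVec]
  rw [smul_inv_smul₀ (sqrt_succ_ne_zero n), Fin.sum_univ_succ, add_comm]
  congr 1
  cases n with
  | zero => simp [fockVec_fin_zero, annihilation_vacuum]
  | succ m =>
    rw [annihilation_fockVec, map_smul, map_sum]
    simp only [map_smul, creation_fockVec, Finset.smul_sum]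
    refine Finset.sum_congr rfl fun k _ => ?_
    rw [smul_comm (inner ℂ φ (f k)) (√(m + 1 : ℝ) : ℂ), inv_smul_smul₀ (sqrt_succ_ne_zero m)]
    simp only [Fin.cons_succ]
    congr 2
    funext i
    refine Fin.cases ?_ (fun i => ?_) i <;> simp

/-- The vacuum is cyclic for the creation fields: an operator that commutes with them is determined
by its value on the vacuum. -/
theorem eq_zero_of_commute_creation {T : Module.End ℂ (FiniteFock h)}
    (hT : ∀ ψ, Commute T (creation ψ)) (h0 : T (vacuum h) = 0) : T = 0 := by
  refine fockVec_hom_ext fun n f => ?_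
  rw [LinearMap.zero_apply]
  induction n with
  | zero => rw [fockVec_fin_zero, h0]
  | succ n ih =>
    have h1 : fockVec f = (√(n + 1 : ℝ) : ℂ)⁻¹ • creation (f 0) (fockVec (Fin.tail f)) := by
      rw [creation_fockVec, inv_smul_smul₀ (sqrt_succ_ne_zero n), Fin.cons_self_tail]
    have h2 := LinearMap.congr_fun (hT (f 0)).eq (fockVec (Fin.tail f))
    rw [Module.End.mul_apply, Module.End.mul_apply, ih, map_zero] at h2
    rw [h1, map_smul, h2, smul_zero]

/-- By the canonical commutation relations and the Jacobi identity, the commutator of two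
annihilation fields commutes with the creation fields; as it kills the vacuum, it vanishes. -/
theorem annihilation_commute (φ φ' : h) : Commute (annihilation φ) (annihilation φ') := by
  rw [commute_iff_lie_eq, Ring.lie_def]
  refine eq_zero_of_commute_creation (fun ψ => ?_) ?_
  · have comm_mul (α β : h) : annihilation α * annihilation β * creation ψ =
        creation ψ * (annihilation α * annihilation β) +
          (inner ℂ α ψ • annihilation β + inner ℂ β ψ • annihilation α) := by
      rw [mul_assoc, annihilation_mul_creation, mul_add, ← mul_assoc, annihilation_mul_creation,
        add_mul, mul_assoc, smul_mul_assoc, one_mul, mul_smul_comm, mul_one, add_assoc]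
    rw [commute_iff_eq, sub_mul, mul_sub, comm_mul, comm_mul]
    abel
  · simp [annihilation_vacuum]

/-! ### The commuting fields on the double Fock space -/

/-- A conjugate-linear isometry reverses the inner product, by polarization. -/
theorem inner_map_map_conj (j : h →ₗᵢ⋆[ℂ] h) (x y : h) : inner ℂ (j x) (j y) = inner ℂ y x := by
  rw [← inner_conj_symm y x, inner_eq_sum_norm_sq_div_four (𝕜 := ℂ) x y,
    inner_eq_sum_norm_sq_div_four (𝕜 := ℂ) (j x) (j y)]
  have h1 : (RCLike.I : ℂ) • j y = j (-((RCLike.I : ℂ) • y)) := by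
    rw [map_neg, LinearIsometry.map_smulₛₗ]
    simp
  rw [h1, ← map_add, ← map_sub, ← map_add, ← map_sub]
  simp only [LinearIsometry.norm_map, sub_neg_eq_add, ← sub_eq_add_neg]
  simp [Complex.conj_ofNat]
  ring

/-- An operator on the first factor, `A ⊗ 1`. -/
def onFirst : Module.End ℂ (FiniteFock h) →ₗ[ℂ] Module.End ℂ (FiniteDoubleFock h) :=
  LinearMap.rTensorHom (FiniteFock h)

/-- An operator on the second factor, `1 ⊗ A`. -/
def onSecond : Module.End ℂ (FiniteFock h) →ₗ[ℂ] Module.End ℂ (FiniteDoubleFock h) :=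
  LinearMap.lTensorHom (FiniteFock h)

theorem onFirst_mul (A B : Module.End ℂ (FiniteFock h)) :
    onFirst (A * B) = onFirst A * onFirst B := LinearMap.rTensor_mul _ A B

theorem onSecond_mul (A B : Module.End ℂ (FiniteFock h)) :
    onSecond (A * B) = onSecond A * onSecond B := LinearMap.lTensor_mul _ A B

@[simp] theorem onFirst_one : onFirst (1 : Module.End ℂ (FiniteFock h)) = 1 :=
  LinearMap.rTensor_id _ _

@[simp] theorem onSecond_one : onSecond (1 : Module.End ℂ (FiniteFock h)) = 1 :=
  LinearMap.lTensor_id _ _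

@[simp] theorem onFirst_tmul (A : Module.End ℂ (FiniteFock h)) (x y : FiniteFock h) :
    onFirst A (x ⊗ₜ y) = A x ⊗ₜ y := rfl

@[simp] theorem onSecond_tmul (A : Module.End ℂ (FiniteFock h)) (x y : FiniteFock h) :
    onSecond A (x ⊗ₜ y) = x ⊗ₜ A y := rfl

theorem onFirst_commute_onSecond (A B : Module.End ℂ (FiniteFock h)) :
    Commute (onFirst A) (onSecond B) :=
  TensorProduct.ext' fun _ _ => rfl

theorem onFirst_commute {A B : Module.End ℂ (FiniteFock h)} (hAB : Commute A B) :
    Commute (onFirst A) (onFirst B) := by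
  rw [commute_iff_eq, ← onFirst_mul, hAB.eq, onFirst_mul]

theorem onSecond_commute {A B : Module.End ℂ (FiniteFock h)} (hAB : Commute A B) :
    Commute (onSecond A) (onSecond B) := by
  rw [commute_iff_eq, ← onSecond_mul, hAB.eq, onSecond_mul]

theorem doubleCreation_eq (j : h →ₗᵢ⋆[ℂ] h) (f : h) :
    doubleCreation j f = onFirst (creation f) + onSecond (annihilation (j f)) := rfl

theorem doubleAnnihilation_eq (j : h →ₗᵢ⋆[ℂ] h) (f : h) :
    doubleAnnihilation j f = onFirst (annihilation f) + onSecond (creation (j f)) := rfl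

theorem onFirst_creation_commute_doubleCreation (j : h →ₗᵢ⋆[ℂ] h) (f g : h) :
    Commute (onFirst (creation f)) (doubleCreation j g) :=
  (onFirst_commute (creation_commute f g)).add_right (onFirst_commute_onSecond _ _)

theorem doubleCreation_commute (j : h →ₗᵢ⋆[ℂ] h) (f g : h) :
    Commute (doubleCreation j f) (doubleCreation j g) :=
  (onFirst_creation_commute_doubleCreation j f g).add_left
    ((onFirst_commute_onSecond _ _).symm.add_right (onSecond_commute (annihilation_commute _ _)))

theorem doubleAnnihilation_commute (j : h →ₗᵢ⋆[ℂ] h) (f g : h) :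
    Commute (doubleAnnihilation j f) (doubleAnnihilation j g) :=
  ((onFirst_commute (annihilation_commute f g)).add_right (onFirst_commute_onSecond _ _)).add_left
    ((onFirst_commute_onSecond _ _).symm.add_right (onSecond_commute (creation_commute _ _)))

/-- The commutators from the two factors are `⟪f, g⟫` and `-⟪j g, j f⟫`; they cancel, since `j`
reverses the inner product. -/
theorem doubleAnnihilation_commute_doubleCreation (j : h →ₗᵢ⋆[ℂ] h) (f g : h) :
    Commute (doubleAnnihilation j f) (doubleCreation j g) := by
  rw [commute_iff_eq, doubleAnnihilation_eq, doubleCreation_eq, add_mul, mul_add, mul_add,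
    ← onFirst_mul, ← onSecond_mul, annihilation_mul_creation, add_mul, mul_add, mul_add,
    ← onFirst_mul, ← onSecond_mul, annihilation_mul_creation, inner_map_map_conj,
    (onFirst_commute_onSecond (annihilation f) (annihilation (j g))).eq,
    (onFirst_commute_onSecond (creation g) (creation (j f))).eq]
  simp only [map_add, map_smul, onFirst_one, onSecond_one]
  abel

/-! ### Vacuum expectations and the permanent -/

variable (h) in
/-- The functional `x ↦ ⟪Ω, x⟫` on the domain of the Boson fields. -/
noncomputable def vacuumFunctional : FiniteFock h →ₗ[ℂ] ℂ :=
  (innerₛₗ ℂ (toFock (vacuum h))) ∘ₗ toFock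

theorem vacuumFunctional_vacuum : vacuumFunctional h (vacuum h) = 1 := by
  have h1 : (symTensor (Fin.elim0 : Fin 0 → h)) = tensor Fin.elim0 := by
    simp [symTensor, Subsingleton.elim (fun i : Fin 0 => (Fin.elim0 _ : h)) Fin.elim0]
  change inner ℂ (toFock (vacuum h)) (toFock (vacuum h)) = 1
  rw [vacuum, fockVec, toFock_sector, (number h 0).inner_map_map]
  change inner ℂ ((symTensor (Fin.elim0 : Fin 0 → h) : UniformSpace.Completion (TensorPow h 0)))
    ((symTensor (Fin.elim0 : Fin 0 → h) : UniformSpace.Completion (TensorPow h 0))) = 1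
  rw [UniformSpace.Completion.inner_coe, h1, inner_tensor]
  simp

theorem vacuumFunctional_fockVec_succ {n : ℕ} (f : Fin (n + 1) → h) :
    vacuumFunctional h (fockVec f) = 0 := by
  change inner ℂ (toFock (vacuum h)) (toFock (fockVec f)) = 0
  rw [vacuum, fockVec, fockVec, toFock_sector, toFock_sector]
  refine (lp.inner_single_left (𝕜 := ℂ) (G := fun n : ℕ => HilbertSymPow h n) 0 _ _).trans ?_
  have h1 : (show lp (fun n : ℕ => HilbertSymPow h n) 2 from
      number h (n + 1) (levelIncl (n + 1) (symVec f))) 0 = 0 :=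
    lp.single_apply_ne (E := fun n : ℕ => HilbertSymPow h n) 2 (n + 1) _ (by simp)
  exact (congrArg _ h1).trans (inner_zero_right _)

theorem vacuumFunctional_creation (φ : h) (x : FiniteFock h) :
    vacuumFunctional h (creation φ x) = 0 := by
  have : vacuumFunctional h ∘ₗ creation φ = 0 := by
    refine fockVec_hom_ext fun n f => ?_
    rw [LinearMap.comp_apply, creation_fockVec, map_smul, vacuumFunctional_fockVec_succ]
    simp
  exact LinearMap.congr_fun this x

variable (h) in
/-- The functional `x ↦ ⟪Ω, x⟫` on the domain of the fields on the double Fock space. -/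
noncomputable def jointVacuumFunctional : FiniteDoubleFock h →ₗ[ℂ] ℂ :=
  (innerₛₗ ℂ (toDoubleFock (jointVacuum h))) ∘ₗ toDoubleFock

theorem jointVacuumFunctional_tmul (x y : FiniteFock h) :
    jointVacuumFunctional h (x ⊗ₜ y) = vacuumFunctional h x * vacuumFunctional h y := by
  change inner ℂ ((toFock (vacuum h) ⊗ₜ[ℂ] toFock (vacuum h) : Fock h ⊗[ℂ] Fock h) :
      UniformSpace.Completion (Fock h ⊗[ℂ] Fock h))
    ((toFock x ⊗ₜ[ℂ] toFock y : Fock h ⊗[ℂ] Fock h) :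
      UniformSpace.Completion (Fock h ⊗[ℂ] Fock h)) = _
  rw [UniformSpace.Completion.inner_coe, TensorProduct.inner_tmul]
  rfl

theorem jointVacuumFunctional_onFirst_creation (φ : h) (x : FiniteDoubleFock h) :
    jointVacuumFunctional h (onFirst (creation φ) x) = 0 := by
  induction x using TensorProduct.induction_on with
  | zero => simp
  | add x y hx hy => rw [map_add, map_add, hx, hy, add_zero]
  | tmul x y => rw [onFirst_tmul, jointVacuumFunctional_tmul, vacuumFunctional_creation, zero_mul]

/-- Under the joint vacuum functional the first parts `B₁⁺(f)` of the fields `B⁺(f)` drop out: they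
commute with all fields `B⁺` and can be moved to the left, where they vanish. -/
theorem jointVacuumFunctional_doubleCreation_prod (j : h →ₗᵢ⋆[ℂ] h) {n : ℕ} (f : Fin n → h)
    (y : FiniteFock h) :
    jointVacuumFunctional h
        ((List.ofFn fun i => doubleCreation j (f i)).reverse.prod (vacuum h ⊗ₜ y)) =
      vacuumFunctional h ((List.ofFn fun i => annihilation (j (f i))).reverse.prod y) := by
  induction n generalizing y with
  | zero => simp [jointVacuumFunctional_tmul, vacuumFunctional_vacuum]
  | succ n ih =>
    rw [List.ofFn_succ, List.ofFn_succ, List.reverse_cons, List.reverse_cons, List.prod_append,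
      List.prod_append, List.prod_singleton, List.prod_singleton, doubleCreation_eq, mul_add,
      LinearMap.add_apply, map_add]
    have hc : Commute (List.ofFn fun i : Fin n => doubleCreation j (f i.succ)).reverse.prod
        (onFirst (creation (f 0))) := by
      refine Commute.list_prod_left _ _ fun x hx => ?_
      rw [List.mem_reverse, List.mem_ofFn'] at hx
      obtain ⟨i, rfl⟩ := hx
      exact (onFirst_creation_commute_doubleCreation j _ _).symm
    rw [hc.eq, Module.End.mul_apply, jointVacuumFunctional_onFirst_creation, zero_add,
      Module.End.mul_apply, onSecond_tmul, ih, Module.End.mul_apply]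

theorem doubleAnnihilation_prod_jointVacuum (j : h →ₗᵢ⋆[ℂ] h) {n : ℕ} (g : Fin n → h) :
    (List.ofFn fun i => doubleAnnihilation j (g i)).prod (jointVacuum h) =
      vacuum h ⊗ₜ (List.ofFn fun i => creation (j (g i))).prod (vacuum h) := by
  induction n with
  | zero => simp [jointVacuum]
  | succ n ih =>
    rw [List.ofFn_succ, List.ofFn_succ, List.prod_cons, List.prod_cons, Module.End.mul_apply,
      ih, doubleAnnihilation_eq, LinearMap.add_apply, onFirst_tmul, onSecond_tmul,
      annihilation_vacuum, TensorProduct.zero_tmul, zero_add, Module.End.mul_apply]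

theorem creation_prod_vacuum {n : ℕ} (ψ : Fin n → h) :
    (List.ofFn fun i => creation (ψ i)).prod (vacuum h) =
      (√(n.factorial : ℝ) : ℂ) • fockVec ψ := by
  induction n with
  | zero => simp [fockVec_fin_zero]
  | succ n ih =>
    rw [List.ofFn_succ, List.prod_cons, Module.End.mul_apply, ih, map_smul, creation_fockVec,
      smul_smul]
    congr 1
    · rw [Nat.factorial_succ, Nat.cast_mul, Real.sqrt_mul (by positivity), mul_comm]
      push_cast
      rfl
    · congr 1
      exact Fin.cons_self_tail ψ

/-- The expansion of a permanent along its first row, in the form of the action of the annihilation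
fields on symmetric tensors. -/
theorem vacuumFunctional_annihilation_prod {n : ℕ} (φ ψ : Fin n → h) :
    vacuumFunctional h ((List.ofFn fun i => annihilation (φ i)).reverse.prod (fockVec ψ)) =
      (√(n.factorial : ℝ) : ℂ)⁻¹ * ∑ σ : Equiv.Perm (Fin n), ∏ i, inner ℂ (φ i) (ψ (σ i)) := by
  induction n with
  | zero => simp [fockVec_fin_zero, vacuumFunctional_vacuum]
  | succ n ih =>
    rw [List.ofFn_succ, List.reverse_cons, List.prod_append, List.prod_singleton,
      Module.End.mul_apply, annihilation_fockVec, map_smul, map_smul, map_sum,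
      map_sum, ← Equiv.sum_comp Equiv.Perm.decomposeFin.symm, Fintype.sum_prod_type,
      Nat.factorial_succ, Nat.cast_mul, Real.sqrt_mul (by positivity), Complex.ofReal_mul, mul_inv,
      mul_assoc, smul_eq_mul, Nat.cast_add, Nat.cast_one]
    congr 1
    rw [Finset.mul_sum]
    refine Finset.sum_congr rfl fun p _ => ?_
    -- `succAbove p` and `swap 0 p ∘ succ` enumerate the same indices
    have h1 : fockVec (fun i : Fin n => ψ (p.succAbove i)) =
        fockVec (fun i : Fin n => ψ (Equiv.swap 0 p i.succ)) := by
      have := symVec_tail ψ (Equiv.swap 0 p)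
      rw [Equiv.swap_apply_left] at this
      exact congrArg (sector n) this.symm
    rw [h1, map_smul, map_smul, ih, smul_eq_mul, mul_left_comm, Finset.mul_sum]
    simp [Fin.prod_univ_succ]

/-- The factors `b i` can be moved to the right of all factors `a k`. They end up in the opposite
order, but commute with each other. -/
theorem prod_reverse_ofFn_mul {M : Type*} [Monoid M] {n : ℕ} (a b : Fin n → M)
    (hab : ∀ i k, Commute (b i) (a k)) (hb : ∀ i k, Commute (b i) (b k)) :
    (List.ofFn fun i => a i * b i).reverse.prod =
      (List.ofFn a).reverse.prod * (List.ofFn b).prod := by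
  induction n with
  | zero => simp
  | succ n ih =>
    have hc : Commute (List.ofFn fun i : Fin n => b i.succ).prod (a 0 * b 0) := by
      refine Commute.list_prod_left _ _ fun x hx => ?_
      rw [List.mem_ofFn'] at hx
      obtain ⟨i, rfl⟩ := hx
      exact (hab _ _).mul_right (hb _ _)
    simp only [List.ofFn_succ, List.reverse_cons, List.prod_append, List.prod_cons,
      List.prod_nil, mul_one]
    rw [ih _ _ (fun i k => hab _ _) (fun i k => hb _ _), mul_assoc, hc.eq]
    simp only [mul_assoc]

/-- The joint moments of the operators `N(f, g)` are permanents. -/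
theorem vacuumExpectation_doubleNumber_prod (j : h →ₗᵢ⋆[ℂ] h) {n : ℕ} (f g : Fin n → h) :
    vacuumExpectation (List.ofFn fun i => doubleNumber j (f i) (g i)).reverse.prod =
      ∑ σ : Equiv.Perm (Fin n), ∏ i, inner ℂ (g (σ i)) (f i) := by
  change jointVacuumFunctional h _ = _
  have h1 : (√(n.factorial : ℝ) : ℂ) ≠ 0 := by
    rw [ne_eq, Complex.ofReal_eq_zero]
    positivity
  unfold doubleNumber
  rw [prod_reverse_ofFn_mul _ _ (fun _ _ => doubleAnnihilation_commute_doubleCreation j _ _)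
      (fun _ _ => doubleAnnihilation_commute j _ _),
    Module.End.mul_apply, doubleAnnihilation_prod_jointVacuum,
    jointVacuumFunctional_doubleCreation_prod, creation_prod_vacuum, map_smul, map_smul,
    vacuumFunctional_annihilation_prod, smul_eq_mul, mul_inv_cancel_left₀ h1]
  simp only [inner_map_map_conj]

/-- The cycles of `σ` partition the index set, and the cycle through `i` consists of the distinct
points `σᵐ i` for `m` below the minimal period of `i`. -/
theorem cycleProduct_eq_prod {n : ℕ} (f g : Fin n → h) (σ : Equiv.Perm (Fin n)) :
    cycleProduct f g σ = ∏ i, inner ℂ (g (σ i)) (f i) := by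
  classical
  unfold cycleProduct
  rw [← Finset.prod_fiberwise Finset.univ (Quotient.mk (Equiv.Perm.SameCycle.setoid σ))]
  refine Finset.prod_congr (by congr) fun c _ => ?_
  have hpow (m : ℕ) (x : Fin n) : (σ ^ m) x = σ^[m] x := by rw [Equiv.Perm.coe_pow]
  refine Finset.prod_nbij (fun m => (σ ^ m) c.out) (fun m _ => ?_) ?_ (fun i hi => ?_)
    (fun m _ => ?_)
  · rw [Finset.mem_filter_univ]
    refine Eq.trans (Quotient.sound ?_) c.out_eq
    exact Equiv.Perm.SameCycle.pow_left (Equiv.Perm.SameCycle.refl σ _)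
  · intro a ha b hb hab
    refine Function.iterate_injOn_Iio_minimalPeriod (f := σ) (x := c.out) ?_ ?_ ?_
    · simpa using ha
    · simpa using hb
    · simpa only [hpow] using hab
  · have hi' : Quotient.mk (Equiv.Perm.SameCycle.setoid σ) i = c := by simpa using hi
    have h1 : Equiv.Perm.SameCycle σ c.out i := Quotient.exact (c.out_eq.trans hi'.symm)
    obtain ⟨m, hm⟩ := h1.exists_nat_pow_eq
    refine ⟨m % Function.minimalPeriod σ c.out, ?_, ?_⟩
    · rw [Finset.mem_coe, Finset.mem_range]
      refine Nat.mod_lt _ (Function.minimalPeriod_pos_of_mem_periodicPts ?_)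
      exact (Function.Injective.mem_periodicPts σ.injective _)
    · simp only [hpow, Function.iterate_mod_minimalPeriod_eq]
      rw [← hpow, hm]
  · rw [pow_succ', Equiv.Perm.mul_apply]

theorem vacuumExpectation_doubleNumber_pow (j : h →ₗᵢ⋆[ℂ] h) (f : h) (n : ℕ) :
    vacuumExpectation (doubleNumber j f f ^ n) = ((n.factorial * (‖f‖ ^ 2) ^ n : ℝ) : ℂ) := by
  have h1 := vacuumExpectation_doubleNumber_prod j (fun _ : Fin n => f) (fun _ => f)
  rw [List.ofFn_const, List.reverse_replicate, List.prod_replicate] at h1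
  rw [h1]
  simp [inner_self_eq_norm_sq_to_K, Fintype.card_perm]

end BosonFock

/-! ### Moments that determine a measure -/

namespace MeasureTheory

open ProbabilityTheory

/-- If the even part of the exponential moment series converges, exponential moments exist. -/
theorem integrable_exp_mul_of_summable_moments {μ : Measure ℝ} [IsProbabilityMeasure μ] {t : ℝ}
    (hμ : ∀ n : ℕ, Integrable (fun x : ℝ => x ^ n) μ)
    (hs : Summable fun n : ℕ => t ^ (2 * n) / (2 * n).factorial * ∫ x, x ^ (2 * n) ∂μ) :
    Integrable (fun x : ℝ => Real.exp (t * x)) μ := by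
  have hF (n : ℕ) (x : ℝ) : (t * x) ^ (2 * n) / (2 * n).factorial =
      t ^ (2 * n) / (2 * n).factorial * x ^ (2 * n) := by ring
  have hnorm (n : ℕ) (x : ℝ) : ‖t ^ (2 * n) / (2 * n).factorial * x ^ (2 * n)‖ =
      t ^ (2 * n) / (2 * n).factorial * x ^ (2 * n) := by
    rw [Real.norm_of_nonneg]
    have := (even_two_mul n).pow_nonneg t
    have := (even_two_mul n).pow_nonneg x
    positivity
  have hsum := hasSum_integral_of_summable_integral_norm (μ := μ)
    (F := fun (n : ℕ) (x : ℝ) => t ^ (2 * n) / (2 * n).factorial * x ^ (2 * n))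
    (fun n => (hμ _).const_mul _) (by simpa only [hnorm, integral_const_mul] using hs)
  have hcosh : ∀ x : ℝ, ∑' n : ℕ, t ^ (2 * n) / (2 * n).factorial * x ^ (2 * n) =
      Real.cosh (t * x) := fun x => by
    rw [Real.cosh_eq_tsum]
    exact tsum_congr fun n => (hF n x).symm
  simp only [hcosh] at hsum
  -- The integral of `cosh (t x)` is at least `1`, the term `n = 0`; in particular it is not the
  -- value `0` which the integral of a non-integrable function has.
  have h1 : (1 : ℝ) ≤ ∫ x, Real.cosh (t * x) ∂μ := by
    refine le_trans ?_ (le_hasSum hsum 0 fun n _ => ?_)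
    · simp
    · refine integral_nonneg fun x => ?_
      rw [Pi.zero_apply, ← hnorm]
      exact norm_nonneg _
  have hint : Integrable (fun x => Real.cosh (t * x)) μ :=
    Integrable.of_integral_ne_zero (by linarith)
  refine (hint.const_mul 2).mono' (by fun_prop) (Filter.Eventually.of_forall fun x => ?_)
  rw [Real.norm_of_nonneg (Real.exp_pos _).le, Real.cosh_eq]
  linarith [Real.exp_pos (-(t * x))]

/-- A measure with exponential moments near `0` is determined by its moments: its moments are the
Taylor coefficients at `0` of its complex moment generating function, which is analytic on a
vertical strip and restricts to the characteristic function on the imaginary axis. -/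
theorem Measure.ext_of_moments {μ ν : Measure ℝ} [IsFiniteMeasure μ] [IsFiniteMeasure ν] {t : ℝ}
    (ht : 0 < t) (hμ : ∀ s ∈ Set.Ioo (-t) t, Integrable (fun x : ℝ => Real.exp (s * x)) μ)
    (hν : ∀ s ∈ Set.Ioo (-t) t, Integrable (fun x : ℝ => Real.exp (s * x)) ν)
    (hmom : ∀ n : ℕ, ∫ x, x ^ n ∂μ = ∫ x, x ^ n ∂ν) : μ = ν := by
  let S : Set ℂ := {z | z.re ∈ Set.Ioo (-t) t}
  have hsub {ρ : Measure ℝ} (hρ : ∀ s ∈ Set.Ioo (-t) t, Integrable (fun x => Real.exp (s * x)) ρ) :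
      Set.Ioo (-t) t ⊆ interior (integrableExpSet id ρ) :=
    interior_maximal hρ isOpen_Ioo
  have h0 : (0 : ℝ) ∈ Set.Ioo (-t) t := ⟨by linarith, ht⟩
  have hS : IsPreconnected S :=
    ((convex_Ioo (-t) t).linear_preimage Complex.reLm).isPreconnected
  have hderiv {ρ : Measure ℝ}
      (hρ : ∀ s ∈ Set.Ioo (-t) t, Integrable (fun x => Real.exp (s * x)) ρ) (n : ℕ) :
      iteratedDeriv n (complexMGF id ρ) 0 = ((∫ x, x ^ n ∂ρ : ℝ) : ℂ) := by
    rw [iteratedDeriv_complexMGF (by simpa using hsub hρ h0), ← integral_complex_ofReal]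
    simp
  have hanal {ρ : Measure ℝ}
      (hρ : ∀ s ∈ Set.Ioo (-t) t, Integrable (fun x => Real.exp (s * x)) ρ) :
      AnalyticOnNhd ℂ (complexMGF id ρ) S :=
    analyticOnNhd_complexMGF.mono fun z hz => hsub hρ hz
  have hev : complexMGF id μ =ᶠ[nhds 0] complexMGF id ν := by
    have h1 := (hanal hμ 0 (by simpa [S] using ht)).hasFPowerSeriesAt
    have h2 := (hanal hν 0 (by simpa [S] using ht)).hasFPowerSeriesAt
    simp only [hderiv hμ, hmom] at h1
    simp only [hderiv hν] at h2
    filter_upwards [h1.eventually_hasSum_sub, h2.eventually_hasSum_sub] with z hz1 hz2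
    exact hz1.unique hz2
  have heq := (hanal hμ).eqOn_of_preconnected_of_eventuallyEq (hanal hν) hS
    (by simpa [S] using ht) hev
  refine Measure.ext_of_charFun ?_
  funext s
  rw [← complexMGF_id_mul_I, ← complexMGF_id_mul_I]
  exact heq (by simpa [S] using ht)

/-- The moment problem with moments `n! cⁿ` is determinate. -/
theorem Measure.ext_of_factorial_moments {μ ν : Measure ℝ} [IsProbabilityMeasure μ]
    [IsProbabilityMeasure ν] {c : ℝ} (hc : 0 < c)
    (hμ : ∀ n : ℕ, Integrable (fun x : ℝ => x ^ n) μ ∧ ∫ x, x ^ n ∂μ = n.factorial * c ^ n)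
    (hν : ∀ n : ℕ, Integrable (fun x : ℝ => x ^ n) ν ∧ ∫ x, x ^ n ∂ν = n.factorial * c ^ n) :
    μ = ν := by
  have hexp {ρ : Measure ℝ} [IsProbabilityMeasure ρ]
      (hρ : ∀ n : ℕ, Integrable (fun x : ℝ => x ^ n) ρ ∧ ∫ x, x ^ n ∂ρ = n.factorial * c ^ n) :
      ∀ s ∈ Set.Ioo (-c⁻¹) c⁻¹, Integrable (fun x : ℝ => Real.exp (s * x)) ρ := by
    intro s hs
    refine integrable_exp_mul_of_summable_moments (fun n => (hρ n).1) ?_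
    have h1 : |s * c| < 1 := by
      rw [abs_mul, abs_of_pos hc, ← lt_div_iff₀ hc, one_div]
      exact abs_lt.2 hs
    have h2 : (s * c) ^ 2 < 1 := (sq_lt_one_iff_abs_lt_one _).2 h1
    refine (summable_geometric_of_lt_one (sq_nonneg _) h2).congr fun n => ?_
    rw [(hρ _).2, ← pow_mul, mul_pow]
    field_simp
  exact Measure.ext_of_moments (inv_pos.2 hc) (hexp hμ) (hexp hν)
    fun n => (hμ n).2.trans (hν n).2.symm

end MeasureTheory

namespace ProbabilityTheory

open MeasureTheory

theorem integral_pow_expMeasure {r : ℝ} (hr : 0 < r) (n : ℕ) :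
    ∫ x, x ^ n ∂expMeasure r = n.factorial * r⁻¹ ^ n := by
  have h1 : ∀ x : ℝ, (gammaPDF 1 r x).toReal • x ^ n =
      (Set.Ici (0 : ℝ)).indicator (fun x => r * (x ^ n * Real.exp (-(r * x)))) x := fun x => by
    by_cases hx : 0 ≤ x
    · rw [gammaPDF, ENNReal.toReal_ofReal (gammaPDFReal_nonneg one_pos hr x), gammaPDFReal,
        if_pos hx, Set.indicator_of_mem (Set.mem_Ici.2 hx)]
      simp
      ring
    · rw [gammaPDF_of_neg (not_le.1 hx), Set.indicator_of_notMem (by simpa using hx)]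
      simp
  rw [expMeasure, gammaMeasure, integral_withDensity_eq_integral_toReal_smul
    (f := gammaPDF 1 r) (measurable_gammaPDFReal 1 r).ennreal_ofReal
    (Filter.Eventually.of_forall fun x => ENNReal.ofReal_lt_top)]
  simp only [h1]
  rw [integral_indicator measurableSet_Ici, integral_Ici_eq_integral_Ioi, integral_const_mul]
  have h2 := Real.integral_rpow_mul_exp_neg_mul_Ioi (a := n + 1) (by positivity) hr
  simp only [add_sub_cancel_right, Real.rpow_natCast, Real.Gamma_nat_eq_factorial] at h2
  rw [h2, ← Nat.cast_add_one, Real.rpow_natCast, one_div, pow_succ]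
  field_simp

theorem integrable_pow_expMeasure {r : ℝ} (hr : 0 < r) (n : ℕ) :
    Integrable (fun x : ℝ => x ^ n) (expMeasure r) := by
  -- A non-integrable function has integral `0`, so a nonzero integral suffices.
  refine Integrable.of_integral_ne_zero ?_
  rw [integral_pow_expMeasure hr]
  positivity

end ProbabilityTheory


/-! ### The vacuum distribution of `N(f, f)` -/

theorem BosonFock.hasVacuumDistribution_doubleNumber {h : Type*} [NormedAddCommGroup h]
    [InnerProductSpace ℂ h] (j : h →ₗᵢ⋆[ℂ] h) {f : h} (hf : f ≠ 0) :
    HasVacuumDistribution (doubleNumber j f f) (ProbabilityTheory.expMeasure (‖f‖ ^ 2)⁻¹) := by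
  have hc : 0 < ‖f‖ ^ 2 := by positivity
  have hr : 0 < (‖f‖ ^ 2)⁻¹ := inv_pos.2 hc
  have hprob := ProbabilityTheory.isProbabilityMeasure_expMeasure hr
  have hexp (n : ℕ) := ProbabilityTheory.integrable_pow_expMeasure hr n
  have hmom (n : ℕ) : ∫ x, x ^ n ∂ProbabilityTheory.expMeasure (‖f‖ ^ 2)⁻¹ =
      n.factorial * (‖f‖ ^ 2) ^ n := by
    rw [ProbabilityTheory.integral_pow_expMeasure hr, inv_inv]
  refine ⟨⟨hprob, fun n => ⟨hexp n, ?_⟩⟩, fun ν hν => ?_⟩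
  · rw [vacuumExpectation_doubleNumber_pow, hmom]
  · have := hν.1
    refine MeasureTheory.Measure.ext_of_factorial_moments hc (fun n => ⟨(hν.2 n).1, ?_⟩)
      fun n => ⟨hexp n, hmom n⟩
    have h1 := (hν.2 n).2
    rw [vacuumExpectation_doubleNumber_pow] at h1
    exact (Complex.ofReal_injective h1).symm

theorem mainTheorem6 {h : Type*} [NormedAddCommGroup h] [InnerProductSpace ℂ h]
    [CompleteSpace h] [TopologicalSpace.SeparableSpace h] (j : h →ₗᵢ⋆[ℂ] h) :
    (∀ f g : h, ⁅doubleAnnihilation j f, doubleCreation j g⁆ = 0) ∧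
    (∀ f g : h, ⁅doubleCreation j f, doubleCreation j g⁆ = 0) ∧
    (∀ f g : h, ⁅doubleAnnihilation j f, doubleAnnihilation j g⁆ = 0) ∧
    (∀ (n : ℕ) (f g : Fin n → h),
      vacuumExpectation (List.ofFn fun i => doubleNumber j (f i) (g i)).reverse.prod =
        ∑ σ : Equiv.Perm (Fin n), cycleProduct f g σ) ∧
    (∀ f : h, f ≠ 0 →
      HasVacuumDistribution (doubleNumber j f f) (ProbabilityTheory.expMeasure (‖f‖ ^ 2)⁻¹)) := by
  refine ⟨fun f g => ?_, fun f g => ?_, fun f g => ?_, fun n f g => ?_, fun f hf => ?_⟩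
  · exact commute_iff_lie_eq.1 (doubleAnnihilation_commute_doubleCreation j f g)
  · exact commute_iff_lie_eq.1 (doubleCreation_commute j f g)
  · exact commute_iff_lie_eq.1 (doubleAnnihilation_commute j f g)
  · simp only [vacuumExpectation_doubleNumber_prod, cycleProduct_eq_prod]
  · exact hasVacuumDistribution_doubleNumber j hf
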